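/- Let $\Delta$ be a simplicial complex on a finite vertex set $V=\{v_1,\dots,v_n\}$ (a family of subsets of $V$, called faces, that is closed under taking subsets and contains $\emptyset$ and every $\{v_i\}$), and let $\dim\Delta=d-1$ be the maximum of $|F|-1$ over the faces $F$. A facet is a face that is maximal under inclusion. Let $k$ be a field and suppose that $\Delta$ is Cohen–Macaulay over $k$, i.e. the Stanley–Reisner ring $k[x_1,\dots,x_n]/I_\Delta$ is a Cohen–Macaulay ring, where $I_\Delta$ is generated by the monomials $\prod_{v_i\in S}x_i$ with $S\subseteq V$, $S\notin\Delta$. Let $G(\Delta)$ be the facet graph of $\Delta$: its vertices are the facets of $\Delta$, and two distinct facets $F,G$ are adjacent if and only if $|F\cap G|=d-1$. Suppose that $G(\Delta)$ is a tree. Then $\Delta$ is shellable: all its facets have the same dimension, and they admit a shelling, i.e. a linear order $F_1,\dots,F_m$ such that for every $i=2,\dots,m$ the complex $\langle F_i\rangle\cap\langle F_1,\dots,F_{i-1}\rangle$ is generated by a non-empty set of maximal proper faces of $\langle F_i\rangle$. (Here $\langle A_1,\dots,A_r\rangle$ denotes the complex of all subsets of the sets $A_1,\dots,A_r$.) Moreover,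 a shelling is obtained by successively adding free vertices of $G(\Delta)$: there exists a linear order $F_1,\dots,F_m$ of the facets such that, for every $j=2,\dots,m$, $F_j$ is a free vertex of the induced subgraph $G(\Delta)|_{\{F_1,\dots,F_j\}}$ (exactly one edge of this subgraph contains $F_j$), and every linear order of the facets with this property is a shelling of $\Delta$. -/

import Mathlib

open MvPolynomial

/-! ### Cohen-Macaulay rings -/

/-- The depth of a local ring `R`: the supremum of the lengths of the `R`-regular sequences
contained in the maximal ideal. -/
noncomputable def localDepth (R : Type*) [CommRing R] [IsLocalRing R] : ℕ∞ :=
  ⨆ rs ∈ {rs : List R | (∀ r ∈ rs, r ∈ IsLocalRing.maximalIdeal R) ∧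
    RingTheory.Sequence.IsRegular R rs}, (rs.length : ℕ∞)

/-- A Noetherian ring is Cohen-Macaulay if, for each maximal ideal `m`, the depth of the local
ring `R_m` equals its Krull dimension. -/
def IsCohenMacaulayRing (R : Type*) [CommRing R] : Prop :=
  IsNoetherianRing R ∧ ∀ (m : Ideal R) [m.IsMaximal],
    (localDepth (Localization.AtPrime m) : WithBot ℕ∞) =
      ringKrullDim (Localization.AtPrime m)

/-! ### Free vertices of graphs -/

/-- A vertex of a graph is free if exactly one edge contains it. -/
def SimpleGraph.IsFreeVertex {α : Type*} (G : SimpleGraph α) (v : α) : Prop :=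
  ∃! e : Sym2 α, e ∈ G.edgeSet ∧ v ∈ e

/-! ### Simplicial complexes

Mathlib's `AbstractSimplicialComplex V` records the nonempty faces only (and contains all
singletons). In the convention used here the empty set is a face as well. -/

namespace AbstractSimplicialComplex

variable {V : Type*} (Δ : AbstractSimplicialComplex V)

/-- The faces of `Δ`, including the empty one. -/
def IsFace (s : Finset V) : Prop := s = ∅ ∨ s ∈ Δ.faces

/-- A facet is a face that is maximal under inclusion. -/
def IsFacet (s : Finset V) : Prop := Maximal Δ.IsFace s

/-- The type of facets of `Δ`. -/
abbrev Facet : Type _ := {F : Finset V // Δ.IsFacet F}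

/-- The dimension of `Δ`: the maximum of `|F| - 1` over the faces `F`. -/
noncomputable def dim : ℤ := sSup {a : ℤ | ∃ F, Δ.IsFace F ∧ a = (F.card : ℤ) - 1}

/-- `Δ` is pure if all its facets have the same dimension. -/
def IsPure : Prop := ∀ F G : Δ.Facet, F.1.card = G.1.card

/-- The Stanley-Reisner ideal of `Δ` over `k`: it is generated by the squarefree monomials
whose support is not a face. -/
noncomputable def stanleyReisnerIdeal (k : Type*) [Field k] : Ideal (MvPolynomial V k) :=
  Ideal.span {f | ∃ s : Finset V, ¬ Δ.IsFace s ∧ f = ∏ i ∈ s, X i}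

/-- `Δ` is Cohen-Macaulay over `k` if its Stanley-Reisner ring is a Cohen-Macaulay ring. -/
def IsCohenMacaulay (k : Type*) [Field k] : Prop :=
  IsCohenMacaulayRing (MvPolynomial V k ⧸ Δ.stanleyReisnerIdeal k)

/-- The facet graph: two distinct facets `F`, `G` are adjacent when `|F ∩ G| = d - 1`, where
`dim Δ = d - 1`. -/
def facetGraph [DecidableEq V] : SimpleGraph Δ.Facet where
  Adj F G := F ≠ G ∧ ((F.1 ∩ G.1).card : ℤ) = Δ.dim
  symm := ⟨fun F G h => ⟨h.1.symm, by rw [Finset.inter_comm]; exact h.2⟩⟩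
  loopless := ⟨fun _ h => h.1 rfl⟩

variable {Δ}

/-- A linear order `F 0, F 1, …` on the facets is a shelling if, for each `i ≥ 1`, the complex
`⟨F i⟩ ∩ ⟨F 0, …, F (i - 1)⟩` is generated by a nonempty set of maximal proper faces of `⟨F i⟩`.
Here the complex generated by a set of finite sets is its lower closure under inclusion. -/
def IsShelling {m : ℕ} (F : Fin m ≃ Δ.Facet) : Prop :=
  ∀ i : Fin m, 0 < (i : ℕ) → ∃ S : Set (Finset V), S.Nonempty ∧
    (∀ E ∈ S, Maximal (fun H : Finset V => H ⊂ (F i).1) E) ∧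
    lowerClosure {(F i).1} ⊓ lowerClosure {H | ∃ j < i, H = (F j).1} = lowerClosure S

/-- A linear order `F 0, F 1, …` on the facets successively adds free vertices if, for each
`j ≥ 1`, `F j` is a free vertex of the subgraph of the facet graph induced on `F 0, …, F j`. -/
def AddsFreeVertices [DecidableEq V] {m : ℕ} (F : Fin m ≃ Δ.Facet) : Prop :=
  ∀ j : Fin m, 0 < (j : ℕ) →
    (Δ.facetGraph.induce {x | ∃ i ≤ j, x = F i}).IsFreeVertex ⟨F j, j, le_rfl, rfl⟩

variable (Δ)

/-- `Δ` is shellable if it is pure and its facets admit a shelling. -/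
def IsShellable : Prop := Δ.IsPure ∧ ∃ (m : ℕ) (F : Fin m ≃ Δ.Facet), IsShelling F

end AbstractSimplicialComplex

/-! ### Ext vanishing and depth over local rings. -/

section Depth

open CategoryTheory Abelian

universe u

/-! The algebraic core is that links of faces of codimension at least two are connected
(`IsCohenMacaulay.card_lt_of_split`). Suppose the facets containing `K` split into classes `A`, `B`
meeting only in `K`. Localize the Stanley-Reisner ring at the point with coordinates 1 on `K` and 0
elsewhere. Depth equals dimension there, so Ext from the residue field vanishes in low degrees;
descending through the coordinates in `K` yields a regular sequence of length two in the ideal `P`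
generated by the variables outside `K`. But `P` lies in a sum of two nonzero ideals with zero
product, contradicting Hartshorne's connectedness argument (`eq_bot_or_eq_bot_of_isRegular_pair`).

Hence any set of facets containing `F` but not `G` is left by an edge among the facets containing `F
∩ G`. In a tree, let `F i` be the earlier neighbor of `F j`. Deleting their edge separates `F j`
from all earlier facets, so that edge is the only one that can leave the component of `F i`. Thus `F
l ∩ F j ⊆ F i` for every `l < j`, and the intersection complex is generated by the single ridge `F i
∩ F j`. -/

/-- If `y` is regular modulo `I`, vanishing of `Ext (R ⧸ (I + y)) M` below degree `n + 1` implies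
vanishing of `Ext (R ⧸ I) M` below degree `n`. -/
theorem subsingleton_ext_quotient_of_sup_span {R : Type u} [CommRing R] [IsLocalRing R]
    [IsNoetherianRing R] (M : ModuleCat.{u} R) [Module.Finite R M] {I : Ideal R} {y : R}
    (hy : y ∈ IsLocalRing.maximalIdeal R) (hreg : ∀ z, y * z ∈ I → z ∈ I) {n : ℕ}
    (h : ∀ i < n + 1, Subsingleton (Ext (ModuleCat.of R (R ⧸ I ⊔ Ideal.span {y})) M i)) :
    ∀ i < n, Subsingleton (Ext (ModuleCat.of R (R ⧸ I)) M i) := by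
  intro i hi
  let f : (R ⧸ I) →ₗ[R] (R ⧸ I) := LinearMap.lsmul R (R ⧸ I) y
  let g : (R ⧸ I) →ₗ[R] (R ⧸ I ⊔ Ideal.span {y}) := Submodule.factor le_sup_left
  have hfg : Function.Exact f g := by
    intro x
    obtain ⟨x, rfl⟩ := Ideal.Quotient.mk_surjective x
    have hg : g (Ideal.Quotient.mk I x) = Ideal.Quotient.mk _ x := rfl
    rw [hg, Ideal.Quotient.eq_zero_iff_mem, Submodule.mem_sup]
    constructor
    · rintro ⟨a, ha, b, hb, rfl⟩
      obtain ⟨c, rfl⟩ := Ideal.mem_span_singleton'.mp hb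
      refine ⟨Ideal.Quotient.mk I c, ?_⟩
      change Ideal.Quotient.mk I (y * c) = _
      rw [Ideal.Quotient.eq]
      have : y * c - (a + c * y) = -a := by ring
      rw [this]
      exact I.neg_mem ha
    · rintro ⟨c, hc⟩
      obtain ⟨c, rfl⟩ := Ideal.Quotient.mk_surjective c
      have hc : Ideal.Quotient.mk I (y * c) = Ideal.Quotient.mk I x := hc
      rw [Ideal.Quotient.eq] at hc
      exact ⟨x - y * c, by simpa using I.neg_mem hc, y * c,
        Ideal.mul_mem_right _ _ (Ideal.mem_span_singleton_self y), by ring⟩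
  let S : ShortComplex (ModuleCat.{u} R) :=
    ModuleCat.shortComplexOfCompEqZero f g hfg.linearMap_comp_eq_zero
  have hS : S.ShortExact :=
    { exact := ModuleCat.shortComplex_exact _ hfg
      mono_f := by
        rw [ModuleCat.mono_iff_injective]
        refine (injective_iff_map_eq_zero f).mpr fun x hx => ?_
        obtain ⟨x, rfl⟩ := Ideal.Quotient.mk_surjective x
        have hx : Ideal.Quotient.mk I (y * x) = 0 := hx
        rw [Ideal.Quotient.eq_zero_iff_mem] at hx ⊢
        exact hreg x hx
      epi_g := by
        rw [ModuleCat.epi_iff_surjective]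
        exact Submodule.factor_surjective (le_sup_left : I ≤ I ⊔ Ideal.span {y}) }
  have hf : S.f = y • 𝟙 (ModuleCat.of R (R ⧸ I)) := rfl
  have : Subsingleton (Ext S.X₃ M (1 + i)) := h (1 + i) (by lia)
  -- The long exact sequence makes multiplication by `y` surjective on this finitely generated Ext
  -- module, so Nakayama kills it.
  have key : (⊤ : Submodule R (Ext (ModuleCat.of R (R ⧸ I)) M i)) ≤
      Ideal.span {y} • (⊤ : Submodule R (Ext (ModuleCat.of R (R ⧸ I)) M i)) := by
    intro e _
    obtain ⟨e', he'⟩ := Ext.contravariant_sequence_exact₁ hS M e rfl (Subsingleton.elim _ _)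
    rw [← he', hf, Ext.mk₀_smul, Ext.smul_comp, Ext.mk₀_id_comp]
    exact Submodule.smul_mem_smul (Ideal.mem_span_singleton_self y) trivial
  have hbot := Submodule.eq_bot_of_le_smul_of_le_jacobson_bot _ _ Module.Finite.fg_top key (by
    rw [IsLocalRing.jacobson_eq_maximalIdeal _ bot_ne_top]
    exact (Ideal.span_singleton_le_iff_mem _).mpr hy)
  exact (Submodule.subsingleton_iff R).mp ((subsingleton_iff_bot_eq_top).mp hbot.symm)

/-- In a local ring, two nonzero ideals with zero product cannot have a regular sequence of length
two in their sum. -/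
theorem eq_bot_or_eq_bot_of_isRegular_pair {R : Type u} [CommRing R] [IsLocalRing R]
    {I J : Ideal R} (hIJ : I * J = ⊥) {a b : R} (ha : a ∈ I ⊔ J) (hb : b ∈ I ⊔ J)
    (hreg : RingTheory.Sequence.IsRegular R [a, b]) : I = ⊥ ∨ J = ⊥ := by
  rw [RingTheory.Sequence.isRegular_cons_iff, RingTheory.Sequence.isRegular_cons_iff] at hreg
  obtain ⟨hra, hrb, -⟩ := hreg
  have hmul : ∀ x ∈ I, ∀ y ∈ J, x * y = 0 := fun x hx y hy => by
    simpa [hIJ] using Ideal.mul_mem_mul hx hy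
  have hcan : ∀ x : R, a * x = 0 → x = 0 := fun x hx => hra (by simpa using hx)
  obtain ⟨a₁, ha₁, a₂, ha₂, rfl⟩ := Submodule.mem_sup.mp ha
  obtain ⟨b₁, hb₁, b₂, hb₂, rfl⟩ := Submodule.mem_sup.mp hb
  -- Both sides equal `a₁ * b₁`. Thus `b` kills `a₁` modulo `a`, and regularity forces `a ∣ a₁`.
  have hcomm : (b₁ + b₂) * a₁ = (a₁ + a₂) * b₁ := by
    linear_combination hmul a₁ ha₁ b₂ hb₂ - hmul b₁ hb₁ a₂ ha₂
  obtain ⟨t, ht⟩ : ∃ t, a₁ = (a₁ + a₂) * t := by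
    have h0 : (Submodule.Quotient.mk a₁ : QuotSMulTop (a₁ + a₂) R) = 0 := by
      apply hrb
      change (Submodule.Quotient.mk ((b₁ + b₂) * a₁) : QuotSMulTop (a₁ + a₂) R) =
        Submodule.Quotient.mk ((b₁ + b₂) * 0)
      rw [hcomm, mul_zero, Submodule.Quotient.mk_zero, Submodule.Quotient.mk_eq_zero]
      exact Submodule.smul_mem_pointwise_smul b₁ (a₁ + a₂) ⊤ trivial
    rw [Submodule.Quotient.mk_eq_zero] at h0
    obtain ⟨t, -, ht⟩ := h0
    exact ⟨t, ht.symm⟩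
  -- Since `a₁ = a * t` and `a₂ = a * (1 - t)`, the nonzerodivisor `a` lies in `I` or in `J`, and it
  -- annihilates the other ideal.
  rcases IsLocalRing.isUnit_or_isUnit_one_sub_self t with hu | hu
  · right
    have haI : a₁ + a₂ ∈ I := (Ideal.mul_unit_mem_iff_mem I hu).mp (ht ▸ ha₁)
    exact eq_bot_iff.mpr fun x hx => hcan x (hmul _ haI x hx)
  · left
    have haJ : a₁ + a₂ ∈ J := by
      refine (Ideal.mul_unit_mem_iff_mem J hu).mp ?_
      have : (a₁ + a₂) * (1 - t) = a₂ := by linear_combination ht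
      rwa [this]
    exact eq_bot_iff.mpr fun x hx => hcan x (by rw [mul_comm]; exact hmul x hx _ haJ)

end Depth

/-! ### Primes in a localized quotient, and regular sequences from depth. -/

section LocalRing

/-- A prime `Q` between `I` and the prime `n` extends to a prime of `(S ⧸ I)_n` lying over `Q`. -/
theorem isPrime_map_localization_quotient {S : Type*} [CommRing S] {I n Q : Ideal S}
    [hm : (n.map (Ideal.Quotient.mk I)).IsPrime] (hQ : Q.IsPrime) (hIQ : I ≤ Q)
    (hQn : Q ≤ n) :
    let φ := (algebraMap (S ⧸ I) (Localization.AtPrime (n.map (Ideal.Quotient.mk I)))).comp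
      (Ideal.Quotient.mk I)
    (Q.map φ).IsPrime ∧ ∀ x, φ x ∈ Q.map φ ↔ x ∈ Q := by
  intro φ
  have hsurj := Ideal.Quotient.mk_surjective (I := I)
  have hker : RingHom.ker (Ideal.Quotient.mk I) = I := Ideal.mk_ker
  have hprime : (Q.map (Ideal.Quotient.mk I)).IsPrime :=
    Ideal.map_isPrime_of_surjective hsurj (hker.trans_le hIQ)
  have hcomap : ∀ J : Ideal S, I ≤ J →
      (J.map (Ideal.Quotient.mk I)).comap (Ideal.Quotient.mk I) = J := fun J hJ => by
    rw [Ideal.comap_map_of_surjective _ hsurj, ← RingHom.ker_eq_comap_bot, hker, sup_eq_left]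
    exact hJ
  have hdisj : Disjoint ((n.map (Ideal.Quotient.mk I)).primeCompl : Set (S ⧸ I))
      (Q.map (Ideal.Quotient.mk I)) := by
    rw [Set.disjoint_left]
    exact fun x hx hx' => hx (Ideal.map_mono hQn hx')
  have hmap : Q.map φ = (Q.map (Ideal.Quotient.mk I)).map
      (algebraMap (S ⧸ I) (Localization.AtPrime (n.map (Ideal.Quotient.mk I)))) :=
    (Ideal.map_map _ _).symm
  refine ⟨?_, fun x => ?_⟩
  · rw [hmap]
    exact IsLocalization.isPrime_of_isPrime_disjoint
      (n.map (Ideal.Quotient.mk I)).primeCompl _ _ hprime hdisj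
  · have h := IsLocalization.under_map_of_isPrime_disjoint
      (n.map (Ideal.Quotient.mk I)).primeCompl
      (Localization.AtPrime (n.map (Ideal.Quotient.mk I))) hprime hdisj
    rw [← Ideal.mem_comap, hmap, ← Ideal.comap_comap, ← Ideal.under_def, h, hcomap Q hIQ]

open RingTheory.Sequence in
/-- If the depth of a local ring is at least `d`, there is a regular sequence in the maximal ideal
of length at least `d`. -/
theorem exists_isRegular_of_le_localDepth {R : Type*} [CommRing R] [IsLocalRing R] {d : ℕ}
    (hd : (d : ℕ∞) ≤ localDepth R) :
    ∃ rs : List R, (∀ r ∈ rs, r ∈ IsLocalRing.maximalIdeal R) ∧ IsRegular R rs ∧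
      d ≤ rs.length := by
  by_contra! h
  rcases d with _ | d
  · exact absurd (h [] (by simp) (IsRegular.nil R R)) (by simp)
  · have : localDepth R ≤ d :=
      iSup₂_le fun rs hrs => by exact_mod_cast Nat.lt_succ_iff.mp (h rs hrs.1 hrs.2)
    exact absurd (hd.trans this) (by norm_cast; lia)

end LocalRing

/-! ### Ideals of coordinate subspaces. -/

section CoordinateIdeals

variable {V k : Type*} [Field k]

/-- The ideal of the affine subspace on which the coordinates in `W` take the values
prescribed by `c`. -/
noncomputable def coordIdeal (c : V → k) (W : Set V) : Ideal (MvPolynomial V k) :=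
  Ideal.span ((fun i => X i - C (c i)) '' W)

theorem coordIdeal_mono (c : V → k) {W W' : Set V} (h : W ⊆ W') :
    coordIdeal c W ≤ coordIdeal c W' :=
  Ideal.span_mono (Set.image_mono h)

theorem coordIdeal_insert (c : V → k) (j : V) (W : Set V) :
    coordIdeal c (insert j W) = coordIdeal c W ⊔ Ideal.span {X j - C (c j)} := by
  rw [coordIdeal, Set.image_insert_eq, Ideal.span_insert, sup_comm, coordIdeal]

-- Substituting the prescribed values is the identity modulo the ideal. Primality follows because
-- the target is a domain.
open Classical in
theorem coordIdeal_eq_ker (c : V → k) (W : Set V) :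
    coordIdeal c W = RingHom.ker
      (aeval (fun i => if i ∈ W then C (c i) else X i) : MvPolynomial V k →ₐ[k] MvPolynomial V k) := by
  set f : MvPolynomial V k →ₐ[k] MvPolynomial V k :=
    aeval (fun i => if i ∈ W then C (c i) else X i) with hf
  apply le_antisymm
  · rw [coordIdeal, Ideal.span_le]
    rintro _ ⟨i, hi, rfl⟩
    simp [RingHom.mem_ker, hf, hi]
  · intro p hp
    have h : (Ideal.Quotient.mkₐ k (coordIdeal c W)).comp f =
        Ideal.Quotient.mkₐ k (coordIdeal c W) := by
      ext i
      by_cases hi : i ∈ W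
      · simp only [hf, AlgHom.comp_apply, aeval_X, hi, if_true, Ideal.Quotient.mkₐ_eq_mk]
        rw [eq_comm, Ideal.Quotient.eq]
        exact Ideal.subset_span ⟨i, hi, rfl⟩
      · simp [hf, hi]
    have hp' : f p = 0 := hp
    have := DFunLike.congr_fun h p
    rw [AlgHom.comp_apply, hp', map_zero] at this
    exact Ideal.Quotient.eq_zero_iff_mem.mp this.symm

theorem coordIdeal_isPrime (c : V → k) (W : Set V) : (coordIdeal c W).IsPrime := by
  rw [coordIdeal_eq_ker]
  exact RingHom.ker_isPrime _

theorem coordIdeal_univ_isMaximal (c : V → k) : (coordIdeal c Set.univ).IsMaximal := by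
  have h : coordIdeal c Set.univ = RingHom.ker (eval c) := by
    rw [coordIdeal_eq_ker]
    ext p
    have : (aeval (fun i => C (c i)) : MvPolynomial V k →ₐ[k] MvPolynomial V k) p =
        C (eval c p) := by
      induction p using MvPolynomial.induction_on with
      | C a => simp [algebraMap_eq]
      | add p q hp hq => rw [map_add, hp, hq, map_add, map_add]
      | mul_X p i hp => rw [map_mul, hp, map_mul, map_mul]; simp
    simp only [RingHom.mem_ker, Set.mem_univ, if_true, this, C_eq_zero]
  rw [h]
  exact RingHom.ker_isMaximal_of_surjective _ fun a => ⟨C a, eval_C a⟩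

theorem X_sub_C_notMem_coordIdeal (c : V → k) {W : Set V} {j : V} (hj : j ∉ W) :
    X j - C (c j) ∉ coordIdeal c W := by
  rw [coordIdeal_eq_ker, RingHom.mem_ker]
  intro h
  have h' := congrArg (eval fun _ => c j + 1) h
  simp [hj] at h'

theorem X_notMem_coordIdeal (c : V → k) {W : Set V} {j : V} (hj : j ∈ W → c j ≠ 0) :
    X j ∉ coordIdeal c W := by
  rw [coordIdeal_eq_ker, RingHom.mem_ker]
  intro h
  by_cases hW : j ∈ W
  · exact hj hW (by simpa [hW] using h)
  · simp [hW] at h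

theorem prod_X_notMem_coordIdeal (c : V → k) {W : Set V} {s : Finset V}
    (hs : ∀ j ∈ s, j ∈ W → c j ≠ 0) : ∏ j ∈ s, X j ∉ coordIdeal c W := by
  have := coordIdeal_isPrime c W
  rw [Ideal.IsPrime.prod_mem_iff]
  rintro ⟨j, hj, h⟩
  exact X_notMem_coordIdeal c (hs j hj) h

theorem X_mem_coordIdeal {c : V → k} {W : Set V} {j : V} (hj : j ∈ W) (hc : c j = 0) :
    X j ∈ coordIdeal c W :=
  Ideal.subset_span ⟨j, hj, by simp [hc]⟩

namespace AbstractSimplicialComplex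

theorem IsFace.mono {Δ : AbstractSimplicialComplex V} {s t : Finset V} (ht : Δ.IsFace t)
    (hst : s ⊆ t) : Δ.IsFace s := by
  rcases s.eq_empty_or_nonempty with rfl | hs
  · exact Or.inl rfl
  · rcases ht with rfl | ht
    · exact absurd (Finset.subset_empty.mp hst) hs.ne_empty
    · exact Or.inr ((Δ.isRelLowerSet_faces ht).2 hst hs)

theorem stanleyReisnerIdeal_le_coordIdeal (Δ : AbstractSimplicialComplex V) {c : V → k}
    {F : Finset V} (hF : Δ.IsFace F) (hc : ∀ i ∉ F, c i = 0) {W : Set V} (hW : ∀ i ∉ F, i ∈ W) :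
    Δ.stanleyReisnerIdeal k ≤ coordIdeal c W := by
  rw [stanleyReisnerIdeal, Ideal.span_le]
  rintro _ ⟨s, hs, rfl⟩
  obtain ⟨i, his, hiF⟩ := Finset.not_subset.mp fun h => hs (hF.mono h)
  exact Ideal.mem_of_dvd _ (Finset.dvd_prod_of_mem _ his) (X_mem_coordIdeal (hW i hiF) (hc i hiF))

end AbstractSimplicialComplex

end CoordinateIdeals

/-! ### Connectedness of links in a Cohen-Macaulay complex. -/

namespace AbstractSimplicialComplex

open CategoryTheory Abelian in
/-- Let the local ring `T` be of depth at least its dimension, and let `φ` behave like the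
localization of the Stanley-Reisner ring of `Δ` at the point with support `K`. If `K` has codimension
at least two, then the facets containing `K` cannot be divided into two nonempty classes such that
facets of different classes always meet exactly in `K`. -/
theorem card_lt_of_split_of_localDepth {V : Type*} [Fintype V] [DecidableEq V] {k : Type*} [Field k]
    {Δ : AbstractSimplicialComplex V} {T : Type*} [CommRing T] [IsLocalRing T]
    [IsNoetherianRing T] (hdepth : ringKrullDim T ≤ localDepth T) (φ : MvPolynomial V k →+* T)
    (hφI : ∀ x ∈ Δ.stanleyReisnerIdeal k, φ x = 0) {K : Finset V} {c : V → k}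
    (hc0 : ∀ i ∉ K, c i = 0) (hc1 : ∀ i ∈ K, c i = 1)
    (hprime : ∀ W : Set V, Δ.stanleyReisnerIdeal k ≤ coordIdeal c W →
      ((coordIdeal c W).map φ).IsPrime ∧ ∀ x, φ x ∈ (coordIdeal c W).map φ ↔ x ∈ coordIdeal c W)
    (hnT : (coordIdeal c Set.univ).map φ = IsLocalRing.maximalIdeal T)
    {A B : Set (Finset V)} (hA : ∀ F ∈ A, Δ.IsFacet F) (hB : ∀ F ∈ B, Δ.IsFacet F)
    (hAB : ∀ F, Δ.IsFacet F → K ⊆ F → F ∈ A ∨ F ∈ B) (hK : ∀ F ∈ A, ∀ G ∈ B, F ∩ G = K)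
    {F₀ G₀ : Finset V} (hF₀ : F₀ ∈ A) (hG₀ : G₀ ∈ B) : F₀.card < K.card + 2 := by
  by_contra! hcard
  set S := MvPolynomial V k
  set I : Ideal S := Δ.stanleyReisnerIdeal k with hI
  have hKF₀ : K ⊆ F₀ := hK F₀ hF₀ G₀ hG₀ ▸ Finset.inter_subset_left
  have hKG₀ : K ⊆ G₀ := hK F₀ hF₀ G₀ hG₀ ▸ Finset.inter_subset_right
  have hle : ∀ F : Finset V, Δ.IsFace F → K ⊆ F → ∀ W : Set V, (∀ i ∉ F, i ∈ W) →
      I ≤ coordIdeal c W := fun F hF hKF W hW =>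
    Δ.stanleyReisnerIdeal_le_coordIdeal hF (fun i hi => hc0 i fun h => hi (hKF h)) hW
  have hKface : Δ.IsFace K := (hA F₀ hF₀).prop.mono hKF₀
  set n : Ideal S := coordIdeal c Set.univ with hn
  have hIn : I ≤ n := hle K hKface subset_rfl _ fun _ _ => trivial
  have hXm : ∀ j, φ (X j - C (c j)) ∈ IsLocalRing.maximalIdeal T := fun j =>
    hnT ▸ Ideal.mem_map_of_mem φ (Ideal.subset_span ⟨j, trivial, rfl⟩)
  -- the dimension is at least the size of a facet
  have hdim : (F₀.card : WithBot ℕ∞) ≤ ringKrullDim T := by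
    have hFW : ∀ U : Finset V, I ≤ coordIdeal c ((↑U ∪ (↑F₀)ᶜ : Set V)) := fun U =>
      hle F₀ (hA F₀ hF₀).prop hKF₀ _ fun i hi => Or.inr hi
    -- Imposing the coordinates of `F₀` one at a time gives a strict chain of primes.
    have key : ∀ U : Finset V, U ⊆ F₀ → (U.card : ℕ∞) ≤ Order.height
        (⟨_, (hprime _ (hFW U)).1⟩ : PrimeSpectrum T) := by
      intro U
      induction U using Finset.induction_on with
      | empty => simp
      | insert j U hj ih =>
        intro hU
        rw [Finset.card_insert_of_notMem hj, Nat.cast_add, Nat.cast_one]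
        refine (add_le_add_left (ih ((Finset.subset_insert j U).trans hU)) 1).trans ?_
        apply Order.height_add_one_le
        have hjn : j ∉ (↑U ∪ (↑F₀)ᶜ : Set V) := by
          have := hU (Finset.mem_insert_self j U)
          simp [hj, this]
        refine lt_of_le_of_ne (Ideal.map_mono (coordIdeal_mono c ?_)) fun h => ?_
        · exact Set.union_subset_union_left _ (by simp)
        · apply X_sub_C_notMem_coordIdeal c hjn
          rw [← (hprime _ (hFW U)).2]
          have h' := congrArg PrimeSpectrum.asIdeal h
          dsimp only at h'
          rw [h']
          exact Ideal.mem_map_of_mem φ (Ideal.subset_span ⟨j, by simp, rfl⟩)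
    calc (F₀.card : WithBot ℕ∞) = ((F₀.card : ℕ∞) : WithBot ℕ∞) := rfl
      _ ≤ _ := WithBot.coe_le_coe.mpr (key F₀ subset_rfl)
      _ ≤ _ := Order.height_le_krullDim _
  have hdepth' : (F₀.card : ℕ∞) ≤ localDepth T := by
    exact_mod_cast hdim.trans hdepth
  obtain ⟨rs, hrsm, hrs, hlen⟩ := exists_isRegular_of_le_localDepth hdepth'
  have hlt : ∀ J : Ideal T, J ≠ ⊤ → J • (⊤ : Submodule T (ModuleCat.of T T)) < ⊤ := fun J hJ => by
    have : J • (⊤ : Submodule T T) < ⊤ := by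
      rw [smul_eq_mul, Ideal.mul_top]
      exact lt_top_iff_ne_top.mpr hJ
    exact this
  have hsupp : ∀ J : Ideal T, Module.support T (ModuleCat.of T (T ⧸ J)) =
      PrimeSpectrum.zeroLocus J := fun J => by
    rw [Module.support_eq_zeroLocus]
    exact congrArg (fun J : Ideal T => PrimeSpectrum.zeroLocus (J : Set T))
      (Ideal.annihilator_quotient (I := J))
  -- vanishing of `Ext` modules of linear sections
  have hext : ∀ U : Finset V, U ⊆ K → ∀ i < F₀.card - U.card, Subsingleton
      (Ext (ModuleCat.of T (T ⧸ (coordIdeal c (↑U)ᶜ).map φ)) (ModuleCat.of T T) i) := by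
    intro U
    induction U using Finset.induction_on with
    | empty =>
      intro _ i hi
      rw [Finset.coe_empty, Set.compl_empty, ← hn, hnT]
      exact ModuleCat.subsingleton_ext_of_exists_isRegular (IsLocalRing.maximalIdeal T) _
        (hsupp _).subset _ (hlt _ Ideal.IsPrime.ne_top') rs hrsm hrs i (by simp at hi; lia)
    | insert j U hj ih =>
      intro hU
      have hjK : j ∈ K := hU (Finset.mem_insert_self j U)
      have hUK : U ⊆ K := (Finset.subset_insert j U).trans hU
      have hIW : I ≤ coordIdeal c ((↑(insert j U) : Set V)ᶜ) :=
        hle K hKface subset_rfl _ fun i hi hiU => hi (hU hiU)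
      have hins : (coordIdeal c ((↑U : Set V)ᶜ)).map φ =
          (coordIdeal c ((↑(insert j U) : Set V)ᶜ)).map φ ⊔ Ideal.span {φ (X j - C (c j))} := by
        have : ((↑U : Set V)ᶜ) = insert j ((↑(insert j U) : Set V)ᶜ) := by
          ext i
          by_cases hij : i = j
          · simp [hij, hj]
          · simp [hij]
        rw [this, coordIdeal_insert, Ideal.map_sup, Ideal.map_span, Set.image_singleton]
      -- Freeing the coordinate `j` costs one degree of vanishing; `X j - C (c j)` is regular modulo
      -- the smaller ideal because that ideal is prime.
      refine subsingleton_ext_quotient_of_sup_span (ModuleCat.of T T) (hXm j) (fun z hz => ?_) ?_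
      · refine ((hprime _ hIW).1.mem_or_mem hz).resolve_left fun h => ?_
        rw [(hprime _ hIW).2] at h
        exact X_sub_C_notMem_coordIdeal c (by simp) h
      · rw [← hins]
        intro i hi
        -- These bounds keep the natural-number subtraction from truncating.
        have h1 := Finset.card_le_card hKF₀
        have h2 := Finset.card_le_card hU
        rw [Finset.card_insert_of_notMem hj] at hi h2
        exact ih hUK i (by lia)
  have hPK := hprime ((↑K : Set V)ᶜ) (hle K hKface subset_rfl _ fun _ hi => hi)
  obtain ⟨l, hl2, hlP, hlreg⟩ := ModuleCat.exists_isRegular_of_exists_subsingleton_ext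
    ((coordIdeal c (↑K)ᶜ).map φ) 2 (ModuleCat.of T T) (hlt _ hPK.1.ne_top) _ (hsupp _)
    fun i hi => hext K subset_rfl i (by lia)
  obtain ⟨a, b, rfl⟩ := List.length_eq_two.mp hl2
  -- ideals of the two classes
  let J : Set (Finset V) → Ideal T := fun A =>
    Ideal.span {f | ∃ s : Finset V, (∀ F ∈ A, ¬ s ⊆ F) ∧ f = φ (∏ i ∈ s, X i)}
  have hJmem : ∀ (A : Set (Finset V)) (s : Finset V), (∀ F ∈ A, ¬ s ⊆ F) →
      φ (∏ i ∈ s, X i) ∈ J A := fun A s hs => Ideal.subset_span ⟨s, hs, rfl⟩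
  have hJmul : J A * J B = ⊥ := by
    rw [Ideal.span_mul_span', Ideal.span_eq_bot]
    rintro _ ⟨_, ⟨s, hs, rfl⟩, _, ⟨t, ht, rfl⟩, rfl⟩
    -- The monomial of `K` is 1 at the point, hence a unit. Multiplying by it reduces to nonfaces
    -- containing `K`, where only facets in `A` or `B` matter.
    have hunit : φ (∏ i ∈ K, X i) ∉ IsLocalRing.maximalIdeal T := by
      rw [← hnT, (hprime Set.univ hIn).2]
      exact prod_X_notMem_coordIdeal c fun j hj _ => by rw [hc1 j hj]; exact one_ne_zero
    have hunit := IsLocalRing.notMem_maximalIdeal.mp hunit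
    rw [← hunit.mul_right_eq_zero]
    dsimp only
    rw [← map_mul, ← map_mul]
    apply hφI
    have hnf : ¬ Δ.IsFace (K ∪ s ∪ t) := fun hf => by
      obtain ⟨F, hsub, hF⟩ := (Set.toFinite {F | Δ.IsFace F}).exists_le_maximal hf
      have hKs := Finset.union_subset_iff.mp (Finset.union_subset_iff.mp hsub).1
      rcases hAB F hF hKs.1 with h | h
      · exact hs F h hKs.2
      · exact ht F h (Finset.union_subset_iff.mp hsub).2
    refine Ideal.mem_of_dvd I ?_ (Ideal.subset_span ⟨_, hnf, rfl⟩)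
    have hdvd : ∀ s t : Finset V,
        ∏ i ∈ s ∪ t, (X i : S) ∣ (∏ i ∈ s, X i) * ∏ i ∈ t, X i := fun s t =>
      ⟨_, (Finset.prod_union_inter).symm⟩
    rw [← mul_assoc]
    exact (hdvd _ _).trans (mul_dvd_mul_right (hdvd _ _) _)
  have hJsup : (coordIdeal c (↑K)ᶜ).map φ ≤ J A ⊔ J B := by
    rw [coordIdeal, Ideal.map_span, Ideal.span_le]
    rintro _ ⟨_, ⟨i, hi, rfl⟩, rfl⟩
    have hX : φ (X i - C (c i)) = φ (∏ j ∈ {i}, X j) := by simp [hc0 i hi]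
    change φ (X i - C (c i)) ∈ _
    rw [hX]
    -- A vertex outside `K` cannot lie in facets of both classes.
    by_cases h : ∀ F ∈ A, ¬ {i} ⊆ F
    · exact Ideal.mem_sup_left (hJmem A _ h)
    · refine Ideal.mem_sup_right (hJmem B _ fun G hG hiG => h fun F hF hiF => hi ?_)
      rw [← hK F hF G hG]
      simp only [Finset.singleton_subset_iff] at hiF hiG
      exact Finset.mem_inter.mpr ⟨hiF, hiG⟩
  have hJne : ∀ (A : Set (Finset V)) (G : Finset V), Δ.IsFacet G → K ⊆ G →
      (∀ F ∈ A, ¬ G ⊆ F) → J A ≠ ⊥ := fun A G hG hKG hGA hbot => by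
    -- The monomial of `G` survives because it avoids the prime of the component belonging to `G`.
    have hp := hprime ((↑G : Set V)ᶜ) (hle G hG.prop hKG _ fun _ hi => hi)
    have h0 := hJmem A G hGA
    rw [hbot, Ideal.mem_bot] at h0
    have : φ (∏ i ∈ G, X i) ∈ (coordIdeal c (↑G)ᶜ).map φ := h0 ▸ zero_mem _
    rw [hp.2] at this
    exact prod_X_notMem_coordIdeal c (fun j hj hj' => absurd hj hj') this
  have hne : ¬ F₀ ⊆ K := fun h => by
    have := Finset.card_le_card h
    lia
  rcases eq_bot_or_eq_bot_of_isRegular_pair hJmul (hJsup (hlP a (by simp)))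
    (hJsup (hlP b (by simp))) hlreg with h | h
  · refine hJne A G₀ (hB G₀ hG₀) hKG₀ (fun F hF hGF => hne ?_) h
    have hG₀K : G₀ = K := by rw [← hK F hF G₀ hG₀, Finset.inter_eq_right.mpr hGF]
    exact ((hB G₀ hG₀).eq_of_le (hA F₀ hF₀).prop (hG₀K ▸ hKF₀)) ▸ hG₀K.le
  · refine hJne B F₀ (hA F₀ hF₀) hKF₀ (fun G hG hFG => hne ?_) h
    rw [← hK F₀ hF₀ G hG, Finset.inter_eq_left.mpr hFG]

/-- The facets containing a face `K` of a Cohen-Macaulay complex cannot be divided into two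
nonempty classes such that facets of different classes always meet exactly in `K`, if `K` has
codimension at least two. -/
theorem IsCohenMacaulay.card_lt_of_split {V : Type*} [Fintype V] [DecidableEq V] {k : Type*}
    [Field k] {Δ : AbstractSimplicialComplex V} (hCM : Δ.IsCohenMacaulay k) {K : Finset V}
    {A B : Set (Finset V)} (hA : ∀ F ∈ A, Δ.IsFacet F) (hB : ∀ F ∈ B, Δ.IsFacet F)
    (hAB : ∀ F, Δ.IsFacet F → K ⊆ F → F ∈ A ∨ F ∈ B) (hK : ∀ F ∈ A, ∀ G ∈ B, F ∩ G = K)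
    {F₀ G₀ : Finset V} (hF₀ : F₀ ∈ A) (hG₀ : G₀ ∈ B) : F₀.card < K.card + 2 := by
  set c : V → k := fun i => if i ∈ K then 1 else 0
  have hc0 : ∀ i ∉ K, c i = 0 := fun i hi => if_neg hi
  have hc1 : ∀ i ∈ K, c i = 1 := fun i hi => if_pos hi
  have hKF₀ : K ⊆ F₀ := hK F₀ hF₀ G₀ hG₀ ▸ Finset.inter_subset_left
  have hIn : Δ.stanleyReisnerIdeal k ≤ coordIdeal c Set.univ :=
    Δ.stanleyReisnerIdeal_le_coordIdeal ((hA F₀ hF₀).prop.mono hKF₀) hc0 fun _ _ => trivial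
  have hnmax := coordIdeal_univ_isMaximal c
  have hm : ((coordIdeal c Set.univ).map
      (Ideal.Quotient.mk (Δ.stanleyReisnerIdeal k))).IsMaximal :=
    Ideal.IsMaximal.map_of_surjective_of_ker_le Ideal.Quotient.mk_surjective
      (Ideal.mk_ker.trans_le hIn)
  obtain ⟨hnoeth, hdepth⟩ := hCM
  have := IsLocalization.isNoetherianRing
    ((coordIdeal c Set.univ).map (Ideal.Quotient.mk (Δ.stanleyReisnerIdeal k))).primeCompl
    (Localization.AtPrime ((coordIdeal c Set.univ).map
      (Ideal.Quotient.mk (Δ.stanleyReisnerIdeal k)))) hnoeth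
  refine card_lt_of_split_of_localDepth (hdepth _).ge ((algebraMap _ (Localization.AtPrime
    ((coordIdeal c Set.univ).map (Ideal.Quotient.mk (Δ.stanleyReisnerIdeal k))))).comp
    (Ideal.Quotient.mk _)) (fun x hx => ?_) hc0 hc1
    (fun W hW => isPrime_map_localization_quotient (coordIdeal_isPrime c W) hW
      (coordIdeal_mono c (Set.subset_univ W))) ?_ hA hB hAB hK hF₀ hG₀
  · rw [RingHom.comp_apply, Ideal.Quotient.eq_zero_iff_mem.mpr hx, map_zero]
  · rw [← Ideal.map_map]
    exact Localization.AtPrime.map_eq_maximalIdeal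

end AbstractSimplicialComplex

/-! ### Vertex orders in connected and acyclic graphs. -/

namespace SimpleGraph

variable {α : Type*} {G : SimpleGraph α}

/-- If every vertex of a sequence but the first is adjacent to an earlier one, two members of the
sequence preceding `F j` are joined by a walk that avoids all edges at `F j`. -/
theorem reachable_deleteEdges_of_lt {m : ℕ} {F : Fin m → α} (hF : Function.Injective F)
    (hadj : ∀ j : Fin m, 0 < (j : ℕ) → ∃ i < j, G.Adj (F i) (F j)) {j : Fin m} {x : α}
    {a b : Fin m} (ha : a < j) (hb : b < j) :
    (G.deleteEdges {s(x, F j)}).Reachable (F a) (F b) := by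
  have hm : 0 < m := j.pos
  have key : ∀ a : Fin m, a < j → (G.deleteEdges {s(x, F j)}).Reachable (F ⟨0, hm⟩) (F a) := by
    intro a
    induction a using WellFoundedLT.induction with
    | ind a ih =>
      intro ha
      rcases Nat.eq_zero_or_pos (a : ℕ) with h0 | h0
      · rw [show a = ⟨0, hm⟩ from Fin.ext h0]
      · obtain ⟨i, hi, hadj⟩ := hadj a h0
        refine (ih i hi (hi.trans ha)).trans (Adj.reachable ?_)
        rw [deleteEdges_adj]
        refine ⟨hadj, fun h => ?_⟩
        rcases Sym2.eq_iff.mp h with ⟨-, h⟩ | ⟨h, -⟩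
        · exact ha.ne (hF h)
        · exact (hi.trans ha).ne (hF h)
  exact (key a ha).symm.trans (key b hb)

/-- The vertices of a finite connected graph can be enumerated so that every vertex but the first
is adjacent to an earlier one. -/
theorem Connected.exists_equiv_fin_adj [Finite α] (hG : G.Connected) :
    ∃ (m : ℕ) (F : Fin m ≃ α), ∀ j : Fin m, 0 < (j : ℕ) → ∃ i < j, G.Adj (F i) (F j) := by
  obtain ⟨m, ⟨e⟩⟩ := Finite.exists_equiv_fin α
  obtain ⟨r⟩ := hG.nonempty
  let f : Fin m → ℕ := fun i => G.dist r (e.symm i)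
  -- Sorted by distance from `r`, the next vertex on a geodesic towards `r` comes strictly earlier.
  let F : Fin m ≃ α := (Tuple.sort f).trans e.symm
  have hmono : Monotone fun i => G.dist r (F i) := Tuple.monotone_sort f
  refine ⟨m, F, fun j hj => ?_⟩
  have hne : F j ≠ r := by
    intro h
    have h0 := hmono (Fin.mk_le_of_le_val hj.le : (⟨0, j.pos⟩ : Fin m) ≤ j)
    dsimp only at h0
    rw [h, dist_self, Nat.le_zero, hG.dist_eq_zero_iff, ← h] at h0
    have := congrArg Fin.val (F.injective h0)
    simp only at this
    lia
  obtain ⟨p, hp⟩ := hG.exists_walk_length_eq_dist (F j) r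
  generalize hv : F j = v at *
  cases p with
  | nil => exact absurd rfl hne
  | @cons _ u _ hadj q =>
    refine ⟨F.symm u, ?_, by rw [Equiv.apply_symm_apply]; exact hadj.symm⟩
    by_contra! hle
    have h1 := hmono hle
    dsimp only at h1
    rw [Equiv.apply_symm_apply, hv, dist_comm, ← hp, Walk.length_cons] at h1
    have h2 := dist_le q
    rw [dist_comm] at h2
    lia

/-- In an enumeration of the vertices of an acyclic graph, where every vertex but the first is
adjacent to an earlier one, the earlier neighbor is unique. -/
theorem IsAcyclic.eq_of_adj_of_lt (hG : G.IsAcyclic) {m : ℕ} {F : Fin m → α}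
    (hF : Function.Injective F)
    (hadj : ∀ j : Fin m, 0 < (j : ℕ) → ∃ i < j, G.Adj (F i) (F j)) {j a b : Fin m}
    (ha : a < j) (hb : b < j) (haj : G.Adj (F a) (F j)) (hbj : G.Adj (F b) (F j)) : a = b := by
  by_contra hab
  -- A second earlier neighbor would give a detour around the bridge from `F a` to `F j`.
  refine isAcyclic_iff_forall_adj_isBridge.mp hG haj ?_
  refine (reachable_deleteEdges_of_lt hF hadj ha hb).trans (Adj.reachable ?_)
  rw [deleteEdges_adj]
  refine ⟨hbj, fun h => ?_⟩
  rcases Sym2.eq_iff.mp h with ⟨h, -⟩ | ⟨h, -⟩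
  · exact hab (hF h).symm
  · exact hb.ne (hF h)

end SimpleGraph

/-! ### From connected links to shellings. -/

namespace AbstractSimplicialComplex

theorem IsFace.card_le_dim_add_one {V : Type*} [Fintype V] {Δ : AbstractSimplicialComplex V}
    {F : Finset V} (hF : Δ.IsFace F) :
    (F.card : ℤ) ≤ Δ.dim + 1 := by
  have : (F.card : ℤ) - 1 ≤ Δ.dim := by
    refine le_csSup ⟨Fintype.card V, ?_⟩ ⟨F, hF, rfl⟩
    rintro _ ⟨G, -, rfl⟩
    have := G.card_le_univ
    lia
  lia

variable {V : Type*} [DecidableEq V] {Δ : AbstractSimplicialComplex V}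

theorem AddsFreeVertices.exists_adj {m : ℕ} {F : Fin m ≃ Δ.Facet} (hF : AddsFreeVertices F)
    (j : Fin m) (hj : 0 < (j : ℕ)) : ∃ i < j, Δ.facetGraph.Adj (F i) (F j) := by
  obtain ⟨e, ⟨he, hje⟩, -⟩ := hF j hj
  obtain ⟨y, rfl⟩ := Sym2.mem_iff_exists.mp hje
  obtain ⟨⟨_, i, hi, rfl⟩, hadj⟩ : ∃ y : {x | ∃ i ≤ j, x = F i}, Δ.facetGraph.Adj (F j) y := ⟨y, he⟩
  exact ⟨i, lt_of_le_of_ne hi fun h => hadj.ne (congrArg F h.symm), hadj.symm⟩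

theorem addsFreeVertices_of_exists_adj (hG : Δ.facetGraph.IsAcyclic) {m : ℕ}
    {F : Fin m ≃ Δ.Facet}
    (hF : ∀ j : Fin m, 0 < (j : ℕ) → ∃ i < j, Δ.facetGraph.Adj (F i) (F j)) :
    AddsFreeVertices F := by
  intro j hj
  obtain ⟨i, hi, hadj⟩ := hF j hj
  refine ⟨s(⟨F j, j, le_rfl, rfl⟩, ⟨F i, i, hi.le, rfl⟩), ⟨hadj.symm, Sym2.mem_mk_left _ _⟩, ?_⟩
  rintro e ⟨he, hje⟩
  obtain ⟨⟨_, l, hl, rfl⟩, rfl⟩ := Sym2.mem_iff_exists.mp hje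
  have hlj : Δ.facetGraph.Adj (F j) (F l) := he
  have hl' : l < j := lt_of_le_of_ne hl fun h => hlj.ne (congrArg F h.symm)
  have := hG.eq_of_adj_of_lt F.injective hF hl' hi hlj.symm hadj
  subst this
  rfl

theorem Facet.card_inter_lt {F G : Δ.Facet} (h : F ≠ G) : (F.1 ∩ G.1).card < F.1.card := by
  refine Finset.card_lt_card (lt_of_le_of_ne Finset.inter_subset_left fun h' => h ?_)
  exact Subtype.ext (F.2.eq_of_le G.2.prop (Finset.inter_eq_left.mp h'))

section Finite

variable [Fintype V]

/-- A neighbor of `F` meets it in `Δ.dim` vertices, a proper subset of `F`, so `F` has the largest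
possible size. -/
theorem Facet.card_eq_of_preconnected (hG : Δ.facetGraph.Preconnected) {F G : Δ.Facet}
    (h : F ≠ G) : (F.1.card : ℤ) = Δ.dim + 1 := by
  have : Nontrivial Δ.Facet := ⟨F, G, h⟩
  obtain ⟨F', hadj⟩ := hG.exists_adj_of_nontrivial F
  have h1 := Facet.card_inter_lt hadj.1
  have h2 := hadj.2
  have h3 := F.2.prop.card_le_dim_add_one
  lia

theorem isPure_of_preconnected (hG : Δ.facetGraph.Preconnected) : Δ.IsPure := by
  intro F G
  rcases eq_or_ne F G with rfl | h
  · rfl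
  · have h1 := Facet.card_eq_of_preconnected hG h
    have h2 := Facet.card_eq_of_preconnected hG h.symm
    lia

/-- In a Cohen-Macaulay complex with connected facet graph, every set of facets that contains `F`
and not `G` has an edge of the facet graph leaving it among the facets containing `F ∩ G`. -/
theorem IsCohenMacaulay.exists_adj_of_mem_of_notMem {k : Type*} [Field k]
    (hCM : Δ.IsCohenMacaulay k) (hG : Δ.facetGraph.Preconnected) {C : Set Δ.Facet}
    {F G : Δ.Facet} (hF : F ∈ C) (hGC : G ∉ C) :
    ∃ F' ∈ C, ∃ G' ∉ C, F.1 ∩ G.1 ⊆ F'.1 ∧ F.1 ∩ G.1 ⊆ G'.1 ∧ Δ.facetGraph.Adj F' G' := by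
  let P : Set (Δ.Facet × Δ.Facet) :=
    {p | p.1 ∈ C ∧ p.2 ∉ C ∧ F.1 ∩ G.1 ⊆ p.1.1 ∧ F.1 ∩ G.1 ⊆ p.2.1}
  -- For a crossing pair with largest intersection `K`, all crossing pairs containing `K` meet
  -- exactly in `K`, so the splitting lemma makes `K` a ridge.
  obtain ⟨⟨F', G'⟩, ⟨hF', hG', hHF, hHG⟩, hmax⟩ :=
    P.toFinite.exists_maximalFor (fun p => (p.1.1 ∩ p.2.1).card) P
      ⟨(F, G), hF, hGC, Finset.inter_subset_left, Finset.inter_subset_right⟩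
  refine ⟨F', hF', G', hG', hHF, hHG, ?_⟩
  have hne : F' ≠ G' := fun h => hG' (h ▸ hF')
  have hH : F.1 ∩ G.1 ⊆ F'.1 ∩ G'.1 := Finset.subset_inter hHF hHG
  have hlt := Facet.card_inter_lt hne
  have hcard := Facet.card_eq_of_preconnected hG hne
  have h := hCM.card_lt_of_split (K := F'.1 ∩ G'.1)
    (A := {E | ∃ E' ∈ C, F'.1 ∩ G'.1 ⊆ E'.1 ∧ E'.1 = E})
    (B := {E | ∃ E' ∉ C, F'.1 ∩ G'.1 ⊆ E'.1 ∧ E'.1 = E}) (F₀ := F'.1) (G₀ := G'.1)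
    (by rintro _ ⟨E, -, -, rfl⟩; exact E.2) (by rintro _ ⟨E, -, -, rfl⟩; exact E.2)
    (fun E hE hKE => by
      by_cases hEC : (⟨E, hE⟩ : Δ.Facet) ∈ C
      · exact Or.inl ⟨_, hEC, hKE, rfl⟩
      · exact Or.inr ⟨_, hEC, hKE, rfl⟩)
    (by
      rintro _ ⟨E, hE, hKE, rfl⟩ _ ⟨E', hE', hKE', rfl⟩
      have hsub := Finset.subset_inter hKE hKE'
      refine (Finset.eq_of_subset_of_card_le hsub ?_).symm
      exact hmax (j := (E, E')) ⟨hE, hE', hH.trans hKE, hH.trans hKE'⟩ (Finset.card_le_card hsub))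
    ⟨F', hF', Finset.inter_subset_left, rfl⟩ ⟨G', hG', Finset.inter_subset_right, rfl⟩
  exact ⟨hne, by lia⟩

theorem IsCohenMacaulay.isShelling_of_addsFreeVertices {k : Type*} [Field k]
    (hCM : Δ.IsCohenMacaulay k) (hG : Δ.facetGraph.IsTree) {m : ℕ} {F : Fin m ≃ Δ.Facet}
    (hF : AddsFreeVertices F) : IsShelling F := by
  intro j hj
  obtain ⟨i, hi, hadj⟩ := hF.exists_adj j hj
  have hsub : ∀ l < j, (F l).1 ∩ (F j).1 ⊆ (F i).1 := by
    intro l hl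
    have hbridge := SimpleGraph.isBridge_iff.mp (SimpleGraph.isAcyclic_iff_forall_adj_isBridge.mp hG.2 hadj)
    set G' := Δ.facetGraph.deleteEdges {s(F i, F j)}
    have hil : G'.Reachable (F i) (F l) :=
      SimpleGraph.reachable_deleteEdges_of_lt F.injective hF.exists_adj hi hl
    -- Apply this to the component of `F i` after deleting its edge to `F j`: only the deleted edge
    -- can leave it.
    obtain ⟨A, hA, B, hB, hHA, hHB, hAB⟩ :=
      hCM.exists_adj_of_mem_of_notMem hG.1.preconnected (C := {x | G'.Reachable (F i) x})
        (F := F l) (G := F j) hil hbridge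
    have hedge : s(A, B) = s(F i, F j) := by
      by_contra hne
      refine hB (SimpleGraph.Reachable.trans hA (SimpleGraph.Adj.reachable ?_))
      exact SimpleGraph.deleteEdges_adj.mpr ⟨hAB, hne⟩
    rcases Sym2.eq_iff.mp hedge with ⟨rfl, -⟩ | ⟨-, rfl⟩
    · exact hHA
    · exact hHB
  have hlt := Facet.card_inter_lt hadj.1.symm
  have hcard := Facet.card_eq_of_preconnected hG.1.preconnected hadj.1.symm
  have hdim := hadj.2
  rw [Finset.inter_comm] at hdim
  refine ⟨{(F j).1 ∩ (F i).1}, Set.singleton_nonempty _, ?_, ?_⟩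
  · rintro _ rfl
    refine ⟨⟨Finset.inter_subset_left, fun h => ?_⟩, fun H hH hle => ?_⟩
    · have := Finset.card_le_card h
      lia
    · have := Finset.card_lt_card hH
      exact (Finset.eq_of_subset_of_card_le hle (by lia)).ge
  · ext H
    simp only [LowerSet.mem_inf_iff, SetLike.mem_coe, mem_lowerClosure, Set.mem_singleton_iff,
      exists_eq_left, Set.mem_ofPred_eq]
    constructor
    · rintro ⟨hH, _, ⟨l, hl, rfl⟩, hHl⟩
      exact Finset.subset_inter hH ((Finset.subset_inter hHl hH).trans (hsub l hl))
    · intro hH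
      exact ⟨hH.trans Finset.inter_subset_left, _, ⟨i, hi, rfl⟩,
        hH.trans Finset.inter_subset_right⟩

end Finite

end AbstractSimplicialComplex

theorem mainTheorem6 {V : Type*} [Fintype V] [DecidableEq V] (k : Type*) [Field k]
    (Δ : AbstractSimplicialComplex V) (hCM : Δ.IsCohenMacaulay k)
    (hTree : Δ.facetGraph.IsTree) :
    Δ.IsShellable ∧
      (∃ (m : ℕ) (F : Fin m ≃ Δ.Facet),
        AbstractSimplicialComplex.AddsFreeVertices F) ∧
      ∀ (m : ℕ) (F : Fin m ≃ Δ.Facet),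
        AbstractSimplicialComplex.AddsFreeVertices F →
          AbstractSimplicialComplex.IsShelling F := by
  obtain ⟨m, F, hF⟩ := hTree.1.exists_equiv_fin_adj
  have hfree := AbstractSimplicialComplex.addsFreeVertices_of_exists_adj hTree.2 hF
  have hshell : ∀ (m : ℕ) (F : Fin m ≃ Δ.Facet), AbstractSimplicialComplex.AddsFreeVertices F →
      AbstractSimplicialComplex.IsShelling F :=
    fun m F hF => hCM.isShelling_of_addsFreeVertices hTree hF
  exact ⟨⟨AbstractSimplicialComplex.isPure_of_preconnected hTree.1.preconnected, m, F,
    hshell m F hfree⟩, ⟨m, F, hfree⟩, hshell⟩
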